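/- All Hilbert spaces are finite-dimensional and all logarithms are to base 2. Let $\mathcal H_N=\mathcal H_M\otimes\mathcal H_L$, where $|X|=\dim\mathcal H_X\ge 1$; write $\mathrm{tr}_{N\setminus M}$ for the partial trace over $\mathcal H_L$, and $n=\log|N|$, $m=\log|M|$. Let $\{U_1,\dots,U_{|D|}\}$ be a unitary 2-design on $\mathcal H_N$, that is, a finite family of unitaries with $$\frac1{|D|}\sum_{i}U_i^{\otimes2}X(U_i^\dagger)^{\otimes2}=\int U^{\otimes2}X(U^\dagger)^{\otimes2}\,dU\qquad\text{for all }X\in\mathcal B(\mathcal H_N\otimes\mathcal H_N),$$ where $dU$ is the Haar probability measure on the unitary group of $\mathcal H_N$. Let $\mathcal H_D$ have orthonormal basis $\{|i\rangle\}_{i=1}^{|D|}$. Entropies: for $\rho_{AB}\ge0$ put $\rho_B=\mathrm{tr}_A[\rho_{AB}]$ and $$H_2(A|B)_\rho=-\log\mathrm{tr}\big[\rho_{AB}(1_A\otimes\rho_B)^{-1/2}\rho_{AB}(1_A\otimes\rho_B)^{-1/2}\big]$$ with generalized inverses and $-\log 0=\infty$; $H_2(A)_\rho$ is the case of one-dimensional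 $B$, i.e. $H_2(A)_\rho=-\log(\mathrm{tr}[\rho^2]/\mathrm{tr}[\rho])$ for $\rho\neq 0$. For a state $\rho_{AB}$, $$H_{\min}(A|B)_\rho=-\inf_{\sigma_B}\inf\{\mu\in\mathbb R:\rho_{AB}\le2^\mu\,1_A\otimes\sigma_B\},$$ where $\sigma_B$ ranges over normalized density matrices on $\mathcal H_B$ and $\inf\emptyset=\infty$. (a) Let $\varepsilon>0$ and $k\in[0,n]$ with $m=\frac{n+k}2-\frac12\log\frac1\varepsilon$. Then $\{U_i\}$ is a strong $(k,\varepsilon)$-quantum Rényi 2-extractor: for every sub-normalized density matrix $\rho_N$ ($\rho_N\ge0$, $\mathrm{tr}[\rho_N]\le1$) with $H_2(N)_\rho\ge k$, the operator $\sigma_{MD}=\frac1{|D|}\sum_i\mathrm{tr}_{N\setminus M}[U_i\rho_NU_i^\dagger]\otimes|i\rangle\langle i|_D$ satisfies $$H_2(MD)_\sigma\ge\log\frac{|M|\cdot|D|}{\varepsilon+1}.$$ (b) Let $\varepsilon>0$ and $k\in[-n,n]$ (so $k$ may be negative) with $m=\frac{n+k}2-\frac12\log\frac1\varepsilon$. Then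 $\{U_i\}$ is a strong $(k,2\sqrt\varepsilon)$-quantum min-entropy extractor against quantum side information: for every finite-dimensional system $R$ and every normalized density matrix $\rho_{NR}$ on $\mathcal H_N\otimes\mathcal H_R$ with $H_{\min}(N|R)_\rho\ge k$, $$\Big\|\frac1{|D|}\sum_i\mathrm{tr}_{N\setminus M}\big[(U_i\otimes1_R)\rho_{NR}(U_i\otimes1_R)^\dagger\big]\otimes|i\rangle\langle i|_D-\frac{1_M}{|M|}\otimes\rho_R\otimes\frac{1_D}{|D|}\Big\|_1\le2\sqrt\varepsilon,$$ where $\|X\|_1=\mathrm{tr}\sqrt{X^\dagger X}$. -/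

import Mathlib

open scoped Kronecker MatrixOrder ComplexOrder
open MeasureTheory

noncomputable section

namespace QExt

/-! ### States, marginals, trace norm -/

/-- Normalized density matrices on `ℂ^A`. -/
def IsState {A : Type*} [Fintype A] (ρ : Matrix A A ℂ) : Prop :=
  ρ.PosSemidef ∧ ρ.trace = 1

/-- Sub-normalized density matrices on `ℂ^A`. -/
def IsSubState {A : Type*} [Fintype A] (ρ : Matrix A A ℂ) : Prop :=
  ρ.PosSemidef ∧ ρ.trace.re ≤ 1

/-- The marginal `ρ_B = tr_A[ρ_AB]`. -/
def marginalSnd {A B : Type*} [Fintype A] (ρ : Matrix (A × B) (A × B) ℂ) : Matrix B B ℂ :=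
  Matrix.of fun b b' => ∑ a, ρ (a, b) (a, b')

/-- The marginal `ρ_A = tr_B[ρ_AB]`. -/
def marginalFst {A B : Type*} [Fintype B] (ρ : Matrix (A × B) (A × B) ℂ) : Matrix A A ℂ :=
  Matrix.of fun a a' => ∑ b, ρ (a, b) (a', b)

/-- The map `tr_L ⊗ id_R` from operators on `(ℂ^M ⊗ ℂ^L) ⊗ ℂ^R` to operators on `ℂ^M ⊗ ℂ^R`. -/
def traceMiddle {M L R : Type*} [Fintype L]
    (X : Matrix ((M × L) × R) ((M × L) × R) ℂ) : Matrix (M × R) (M × R) ℂ :=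
  Matrix.of fun p q => ∑ l, X ((p.1, l), p.2) ((q.1, l), q.2)

/-- The trace norm `‖X‖₁ = tr |X|`, with `|X| = (X† X)^{1/2}`. -/
def traceNorm {A : Type*} [Fintype A] [DecidableEq A] (X : Matrix A A ℂ) : ℝ :=
  (CFC.abs X).trace.re

/-- The projector `|i⟩⟨i|` onto a vector of the standard basis of `ℂ^D`. -/
def basisProj {D : Type*} [DecidableEq D] (i : D) : Matrix D D ℂ := Matrix.single i i 1

/-! ### Entropies (base-2 logarithms, values in the extended reals) -/

/-- `-log₂ x` for `x ≥ 0`, with `-log₂ 0 = ∞`. -/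
def negLog2 (x : ℝ) : EReal := if x = 0 then ⊤ else ((-Real.logb 2 x : ℝ) : EReal)

/-- The conditional Rényi 2-entropy
`H₂(A|B)_ρ = -log₂ tr[ρ_AB (1_A ⊗ ρ_B)^{-1/2} ρ_AB (1_A ⊗ ρ_B)^{-1/2}]`.
The power `CFC.rpow _ (-1/2)` acts on eigenvalues and sends the eigenvalue `0` to `0`, so it is
the generalized inverse square root. -/
def condRenyi2 {A B : Type*} [Fintype A] [Fintype B] [DecidableEq A] [DecidableEq B]
    (ρ : Matrix (A × B) (A × B) ℂ) : EReal :=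
  negLog2 (ρ * CFC.rpow ((1 : Matrix A A ℂ) ⊗ₖ marginalSnd ρ) (-1 / 2) *
    ρ * CFC.rpow ((1 : Matrix A A ℂ) ⊗ₖ marginalSnd ρ) (-1 / 2)).trace.re

/-- The Rényi 2-entropy `H₂(A)_ρ`: the conditional entropy with a one-dimensional conditioning
system. -/
def renyi2 {A : Type*} [Fintype A] [DecidableEq A] (ρ : Matrix A A ℂ) : EReal :=
  condRenyi2 (A := A) (B := Unit) (ρ.submatrix Prod.fst Prod.fst)

/-- The max-relative entropy `D_max(ω‖σ) = inf {μ ∈ ℝ : ω ≤ 2^μ σ}` (`∞` if there is no such `μ`). -/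
def maxRelEntropy {A : Type*} [Fintype A] (ω σ : Matrix A A ℂ) : EReal :=
  sInf {x : EReal | ∃ μ : ℝ, x = (μ : EReal) ∧ ((((2 : ℝ) ^ μ : ℝ) : ℂ) • σ - ω).PosSemidef}

/-- The conditional min-entropy `H_min(A|B)_ω = - inf_{σ_B ∈ S(ℂ^B)} D_max(ω_AB ‖ 1_A ⊗ σ_B)`. -/
def condMinEntropy {A B : Type*} [Fintype A] [Fintype B] [DecidableEq A]
    (ω : Matrix (A × B) (A × B) ℂ) : EReal :=
  -⨅ σ : {σ : Matrix B B ℂ // IsState σ}, maxRelEntropy ω ((1 : Matrix A A ℂ) ⊗ₖ σ.1)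

/-! ### Haar measure and unitary 2-designs -/

instance unitaryGroup_compactSpace {n : Type*} [Fintype n] [DecidableEq n] :
    CompactSpace (Matrix.unitaryGroup n ℂ) := by
  have hc : IsClosed {A : Matrix n n ℂ | A ∈ Matrix.unitaryGroup n ℂ} := by
    have : {A : Matrix n n ℂ | A ∈ Matrix.unitaryGroup n ℂ} =
        {A : Matrix n n ℂ | A * star A = 1} := by
      ext A; exact Matrix.mem_unitaryGroup_iff
    rw [this]
    exact isClosed_eq (by fun_prop) continuous_const
  have hb : IsCompact (Set.pi Set.univ fun _ : n => Set.pi Set.univ fun _ : n =>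
      Metric.closedBall (0 : ℂ) 1) :=
    isCompact_univ_pi fun _ => isCompact_univ_pi fun _ => isCompact_closedBall _ _
  refine isCompact_iff_compactSpace.mp (IsCompact.of_isClosed_subset hb hc ?_)
  intro A hA i _ j _
  simpa using entry_norm_bound_of_unitary hA i j

/-- The Borel σ-algebra on the unitary group. -/
instance unitaryGroup_measurableSpace {n : Type*} [Fintype n] [DecidableEq n] :
    MeasurableSpace (Matrix.unitaryGroup n ℂ) := borel _

instance unitaryGroup_borelSpace {n : Type*} [Fintype n] [DecidableEq n] :
    BorelSpace (Matrix.unitaryGroup n ℂ) := ⟨rfl⟩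

/-- The Haar probability measure on the unitary group. -/
def haarUnitary (n : Type*) [Fintype n] [DecidableEq n] : Measure (Matrix.unitaryGroup n ℂ) :=
  Measure.haarMeasure ⊤

/-- `U^{⊗2} X (U†)^{⊗2}`. -/
def twirlTwo {n : Type*} [Fintype n] [DecidableEq n] (U : Matrix.unitaryGroup n ℂ)
    (X : Matrix (n × n) (n × n) ℂ) : Matrix (n × n) (n × n) ℂ :=
  ((U : Matrix n n ℂ) ⊗ₖ (U : Matrix n n ℂ)) * X *
    ((U : Matrix n n ℂ).conjTranspose ⊗ₖ (U : Matrix n n ℂ).conjTranspose)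

/-- The finite family `U` of unitaries is a unitary 2-design: for all operators `X` on `ℂ^n ⊗ ℂ^n`,
`(1/|D|) ∑_i U_i^{⊗2} X (U_i†)^{⊗2} = ∫ U^{⊗2} X (U†)^{⊗2} dU`, where the (continuous) matrix-valued
function is integrated entrywise against the Haar probability measure. -/
def IsUnitaryTwoDesign {n D : Type*} [Fintype n] [DecidableEq n] [Fintype D]
    (U : D → Matrix.unitaryGroup n ℂ) : Prop :=
  ∀ X : Matrix (n × n) (n × n) ℂ,
    ((Fintype.card D : ℂ)⁻¹ • ∑ i, twirlTwo (U i) X) =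
      Matrix.of fun p q => ∫ V, twirlTwo V X p q ∂(haarUnitary n)

/-! ### Extractors
The input space is `ℂ^N = ℂ^M ⊗ ℂ^L`, so that the trace over `N \ M` is the trace over `L`. -/

/-- `(1/|D|) ∑_i tr_{N\M}[U_i ρ_N U_i†] ⊗ |i⟩⟨i|_D`. -/
def extractorOutput {M L D : Type*} [Fintype M] [Fintype L] [Fintype D]
    [DecidableEq M] [DecidableEq L] [DecidableEq D]
    (U : D → Matrix.unitaryGroup (M × L) ℂ) (ρ : Matrix (M × L) (M × L) ℂ) :
    Matrix (M × D) (M × D) ℂ :=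
  (Fintype.card D : ℂ)⁻¹ • ∑ i,
    marginalFst ((U i : Matrix (M × L) (M × L) ℂ) * ρ *
      (U i : Matrix (M × L) (M × L) ℂ).conjTranspose) ⊗ₖ basisProj i

/-- `(1/|D|) ∑_i tr_{N\M}[U_i ρ_{NR} U_i†] ⊗ |i⟩⟨i|_D`, where `U_i` acts as `U_i ⊗ 1_R`. -/
def extractorOutputQSI {M L D R : Type*} [Fintype M] [Fintype L] [Fintype D] [Fintype R]
    [DecidableEq M] [DecidableEq L] [DecidableEq D] [DecidableEq R]
    (U : D → Matrix.unitaryGroup (M × L) ℂ) (ρ : Matrix ((M × L) × R) ((M × L) × R) ℂ) :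
    Matrix ((M × R) × D) ((M × R) × D) ℂ :=
  (Fintype.card D : ℂ)⁻¹ • ∑ i,
    traceMiddle (((U i : Matrix (M × L) (M × L) ℂ) ⊗ₖ (1 : Matrix R R ℂ)) * ρ *
      ((U i : Matrix (M × L) (M × L) ℂ) ⊗ₖ (1 : Matrix R R ℂ)).conjTranspose) ⊗ₖ basisProj i

/-- Strong `(k, ε)`-quantum Rényi 2-extractor. -/
def IsStrongRenyi2Extractor {M L D : Type*} [Fintype M] [Fintype L] [Fintype D]
    [DecidableEq M] [DecidableEq L] [DecidableEq D]
    (U : D → Matrix.unitaryGroup (M × L) ℂ) (k ε : ℝ) : Prop :=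
  ∀ ρ : Matrix (M × L) (M × L) ℂ, IsSubState ρ → (k : EReal) ≤ renyi2 ρ →
    ((Real.logb 2 (Fintype.card M * Fintype.card D / (ε + 1)) : ℝ) : EReal) ≤
      renyi2 (extractorOutput U ρ)

/-- Strong `(k, δ)`-quantum min-entropy extractor against (finite-dimensional) quantum side
information. -/
def IsStrongMinExtractorQSI {M L D : Type*} [Fintype M] [Fintype L] [Fintype D]
    [DecidableEq M] [DecidableEq L] [DecidableEq D]
    (U : D → Matrix.unitaryGroup (M × L) ℂ) (k δ : ℝ) : Prop :=
  ∀ (R : Type) [Fintype R] [DecidableEq R] (ρ : Matrix ((M × L) × R) ((M × L) × R) ℂ),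
    IsState ρ → (k : EReal) ≤ condMinEntropy ρ →
    traceNorm (extractorOutputQSI U ρ -
      (((Fintype.card M : ℂ)⁻¹ • (1 : Matrix M M ℂ)) ⊗ₖ marginalSnd ρ) ⊗ₖ
        ((Fintype.card D : ℂ)⁻¹ • (1 : Matrix D D ℂ))) ≤ δ

end QExt

end

/-!
A unitary 2-design reproduces second moments of the Haar measure, so everything reduces to one
twirl. By invariance of the Haar measure the twirled operator commutes with every `V ⊗ V`, hence is
`a 1 + b F` with `F` the swap (`commutant_eq`, shown by testing against diagonal phases,
permutations, and one unitary mixing two basis vectors). The coefficients `a`, `b` are pinned down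
by the trace and by the pairing with `F`. Pairing instead with the operator that swaps only the two
copies of `ℂ^M` gives the average of `tr[(tr_L[U_i X U_i†])²]`; applied to the blocks of an operator
`X` on `N ⊗ R`, it yields (`average_purity_traceMiddle_le`)
`|M| · avg tr[(tr_L[U_i X U_i†])²] ≤ tr[X_R²] + (|M| / |L|) tr[X²]`.
The assumption on `m` says exactly that `|M| / |L| = 2^k ε` (`card_div_card_eq`).

Part (a) is the case of trivial `R`: the 2-entropy of the input bounds `tr[ρ²]` by
`2^{-k} tr[ρ]`, and the block-diagonal output has purity `1/|D|` times the average purity.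

For part (b), a weighted Cauchy–Schwarz inequality (`traceNorm_sq_le`) bounds `‖Δ‖₁²` by
`tr[W] tr[(W^{-1/4} Δ W^{-1/4})²]`, where `Δ` is the deviation of the output from the ideal one and
`W = 1_M ⊗ τ ⊗ 1_D` for an invertible state `τ` with `ρ ≤ c (1 ⊗ τ)`. The conjugation by `τ^{-1/4}`
commutes with the action of the design, so the second factor is the averaged purity of
`ρ' = τ^{-1/4} ρ τ^{-1/4}` minus that of the ideal output. The term `tr[ρ'_R²]` cancels, and
`tr[ρ'²] ≤ c` bounds the rest (`traceNorm_extractorOutputQSI_sub_sq_le`). The min-entropy condition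
supplies a state dominating `ρ` with a constant below `2 · 2^{-k}`; making it invertible by mixing
costs another factor `2`, and the resulting bound `4ε` is the square of `2√ε`.
-/

noncomputable section

namespace QExt

/-! ### The commutant of `V ⊗ V` -/

/-- The swap operator `|i⟩|j⟩ ↦ |j⟩|i⟩` on `ℂ^n ⊗ ℂ^n`. -/
def swapMatrix (n : Type*) [DecidableEq n] : Matrix (n × n) (n × n) ℂ :=
  Matrix.of fun p q => if p.1 = q.2 ∧ p.2 = q.1 then 1 else 0

section Commutant

variable {n : Type*} [Fintype n] [DecidableEq n]

lemma diagonal_phase_mem_unitaryGroup (x : n) :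
    Matrix.diagonal (fun i => if i = x then Complex.I else 1) ∈ Matrix.unitaryGroup n ℂ := by
  rw [Matrix.mem_unitaryGroup_iff, Matrix.star_eq_conjTranspose, Matrix.diagonal_conjTranspose,
    Matrix.diagonal_mul_diagonal, ← Matrix.diagonal_one]
  congr 1
  funext i
  by_cases h : i = x <;> simp [h]

lemma permMatrix_mul_conjTranspose (σ : Equiv.Perm n) :
    σ.permMatrix ℂ * (σ.permMatrix ℂ).conjTranspose = 1 := by
  rw [Matrix.conjTranspose_permMatrix, ← Matrix.permMatrix_mul]
  simp

lemma permMatrix_mem_unitaryGroup (σ : Equiv.Perm n) :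
    σ.permMatrix ℂ ∈ Matrix.unitaryGroup n ℂ := by
  rw [Matrix.mem_unitaryGroup_iff, Matrix.star_eq_conjTranspose, permMatrix_mul_conjTranspose]

/-- `(3 + 4iP)/5` is unitary for a transposition matrix `P`, because `P` is a Hermitian
involution. -/
lemma swap_combination_mem_unitaryGroup (x y : n) :
    (3 / 5 : ℂ) • (1 : Matrix n n ℂ) + (4 / 5 * Complex.I) • (Equiv.swap x y).permMatrix ℂ ∈
      Matrix.unitaryGroup n ℂ := by
  have hP : ((Equiv.swap x y).permMatrix ℂ).conjTranspose = (Equiv.swap x y).permMatrix ℂ := by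
    rw [Matrix.conjTranspose_permMatrix, Equiv.swap_inv]
  have hPP := permMatrix_mul_conjTranspose (Equiv.swap x y)
  rw [hP] at hPP
  rw [Matrix.mem_unitaryGroup_iff, Matrix.star_eq_conjTranspose, Matrix.conjTranspose_add,
    Matrix.conjTranspose_smul, Matrix.conjTranspose_smul, hP]
  simp only [Matrix.conjTranspose_one, add_mul, mul_add, smul_mul_assoc, mul_smul_comm, one_mul,
    mul_one, hPP, star_mul', Complex.star_def, Complex.conj_I, map_div₀, map_ofNat]
  have h1 : (3 / 5 : ℂ) * (3 / 5) + (4 / 5 * Complex.I) * (4 / 5 * -Complex.I) = 1 := by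
    linear_combination (-16 / 25 : ℂ) * Complex.I_mul_I
  have h2 : (4 / 5 * -Complex.I) * (3 / 5) + (3 / 5) * (4 / 5 * Complex.I) = 0 := by ring
  linear_combination (norm := module) h1 • (1 : Matrix n n ℂ) +
    h2 • ((Equiv.swap x y).permMatrix ℂ)

variable {Y : Matrix (n × n) (n × n) ℂ}
  (hY : ∀ V ∈ Matrix.unitaryGroup n ℂ, (V ⊗ₖ V) * Y = Y * (V ⊗ₖ V))

include hY

/-- Commutation with diagonal phases leaves only the entries whose row and column index agree up to
order. -/
lemma commutant_entry_eq_zero {i j k l : n} (h₁ : ¬(i = k ∧ j = l)) (h₂ : ¬(i = l ∧ j = k)) :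
    Y (i, j) (k, l) = 0 := by
  have key : ∀ x : n, ((if i = x then Complex.I else 1) * (if j = x then Complex.I else 1) -
      (if k = x then Complex.I else 1) * (if l = x then Complex.I else 1)) *
        Y (i, j) (k, l) = 0 := by
    intro x
    have h := congrFun (congrFun (hY _ (diagonal_phase_mem_unitaryGroup x)) (i, j)) (k, l)
    rw [Matrix.diagonal_kronecker_diagonal, Matrix.diagonal_mul, Matrix.mul_diagonal] at h
    linear_combination h
  -- The powers `1, I, I²` are distinct, so the phase at `x` counts how often `x` occurs in a pair.
  have hI1 : Complex.I ≠ 1 := fun h => by simpa using congrArg Complex.im h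
  have hI2 : (1 : ℂ) ≠ Complex.I := hI1.symm
  have hI3 : (-1 : ℂ) ≠ 1 := by norm_num
  have hI4 : (-1 : ℂ) ≠ Complex.I := fun h => by simpa using congrArg Complex.im h
  by_contra hne
  have key' : ∀ x : n, (if i = x then Complex.I else 1) * (if j = x then Complex.I else 1) =
      (if k = x then Complex.I else 1) * (if l = x then Complex.I else 1) := fun x =>
    sub_eq_zero.mp ((mul_eq_zero.mp (key x)).resolve_right hne)
  have ki := key' i
  have kj := key' j
  have kk := key' k
  have kl := key' l
  by_cases hij : i = j <;> by_cases hik : i = k <;> by_cases hil : i = l <;>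
    by_cases hjk : j = k <;> by_cases hjl : j = l <;> simp_all [eq_comm]

lemma commutant_entry_perm (σ : Equiv.Perm n) (i j k l : n) :
    Y (σ i, σ j) (σ k, σ l) = Y (i, j) (k, l) := by
  have h := congrFun (congrFun (hY _ (permMatrix_mem_unitaryGroup σ)) (i, j)) (σ k, σ l)
  simpa [Matrix.mul_apply, Fintype.sum_prod_type, Equiv.Perm.permMatrix, PEquiv.toMatrix_apply,
    ite_and, Finset.sum_ite_eq, eq_comm] using h

/-- The unitary `(3 + 4iP)/5`, with `P` the transposition of `x` and `y`, links the fully diagonal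
entries to the others: this is the `((x, x), (x, y))` entry of the commutation relation. -/
lemma commutant_entry_diag {x y : n} (hxy : x ≠ y) :
    Y (x, x) (x, x) = Y (x, y) (x, y) + Y (x, y) (y, x) := by
  have h := congrFun (congrFun (hY _ (swap_combination_mem_unitaryGroup x y)) (x, x)) (x, y)
  have z1 : Y (x, x) (x, y) = 0 := commutant_entry_eq_zero hY (by simp [hxy]) (by simp [hxy])
  have z2 : Y (y, y) (x, y) = 0 :=
    commutant_entry_eq_zero hY (by simp [hxy.symm]) (by simp [hxy.symm])
  have z3 : Y (x, x) (y, x) = 0 := commutant_entry_eq_zero hY (by simp [hxy]) (by simp [hxy])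
  have z4 : Y (x, x) (y, y) = 0 := commutant_entry_eq_zero hY (by simp [hxy]) (by simp [hxy])
  have z5 : Y (y, x) (x, y) = Y (x, y) (y, x) := by
    simpa using commutant_entry_perm hY (Equiv.swap x y) x y y x
  have hσ : ∀ z w : n, Equiv.swap x y z = w ↔ z = Equiv.swap x y w := fun z w => by
    rw [← Equiv.eq_symm_apply, Equiv.symm_swap]
  simp [Matrix.mul_apply, Fintype.sum_prod_type, Equiv.Perm.permMatrix, PEquiv.toMatrix_apply,
    Matrix.one_apply, hσ, add_mul, mul_add, Finset.sum_add_distrib,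
    z1, z2, z3, z4, z5] at h
  linear_combination (25 / 12 * Complex.I) * h + (Y (x, x) (x, x) - Y (x, y) (x, y) -
    Y (x, y) (y, x)) * Complex.I_mul_I

/-- An operator commuting with every `V ⊗ V` is a combination of the identity and the swap. -/
theorem commutant_eq : ∃ a b : ℂ, Y = a • 1 + b • swapMatrix n := by
  by_cases hn : ∃ x y : n, x ≠ y
  · obtain ⟨x, y, hxy⟩ := hn
    refine ⟨Y (x, y) (x, y), Y (x, y) (y, x), ?_⟩
    have hd : ∀ i j : n, i ≠ j → ∃ σ : Equiv.Perm n, σ x = i ∧ σ y = j := by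
      intro i j hij
      refine ⟨(Equiv.swap x i).trans (Equiv.swap (Equiv.swap x i y) j), ?_, ?_⟩
      · have : i ≠ Equiv.swap x i y := by
          intro h
          have := congrArg (Equiv.swap x i) h
          simp at this
          exact hxy this
        simp [Equiv.swap_apply_of_ne_of_ne this hij]
      · simp
    ext ⟨i, j⟩ ⟨k, l⟩
    by_cases h1 : i = k ∧ j = l
    · obtain ⟨rfl, rfl⟩ := h1
      by_cases hij : i = j
      · subst hij
        have h3 := commutant_entry_perm hY (Equiv.swap x i) x x x x
        simp only [Equiv.swap_apply_left] at h3
        simp [h3, commutant_entry_diag hY hxy, swapMatrix]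
      · obtain ⟨σ, rfl, rfl⟩ := hd i j hij
        simp [commutant_entry_perm hY, swapMatrix, hxy]
    · by_cases h2 : i = l ∧ j = k
      · obtain ⟨rfl, rfl⟩ := h2
        have hij : i ≠ j := fun h => h1 ⟨h, h.symm⟩
        obtain ⟨σ, rfl, rfl⟩ := hd i j hij
        simp [commutant_entry_perm hY, swapMatrix, hxy]
      · rw [commutant_entry_eq_zero hY h1 h2]
        simp only [swapMatrix, Matrix.add_apply, Matrix.smul_apply, Matrix.one_apply, Prod.mk.injEq,
          h1, h2, Matrix.of_apply, if_false, smul_zero, add_zero]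
  · push Not at hn
    have hs : Subsingleton n := ⟨hn⟩
    by_cases hne : Nonempty n
    · obtain ⟨x⟩ := hne
      refine ⟨Y (x, x) (x, x), 0, ?_⟩
      ext ⟨i, j⟩ ⟨k, l⟩
      simp [hn i x, hn j x, hn k x, hn l x]
    · refine ⟨0, 0, ?_⟩
      ext ⟨i, j⟩
      exact (hne ⟨i⟩).elim

end Commutant

/-! ### Twirling with a unitary 2-design -/

section Twirl

variable {n : Type*} [Fintype n] [DecidableEq n]

instance haarUnitary_isMulLeftInvariant : (haarUnitary n).IsMulLeftInvariant := by
  unfold haarUnitary; infer_instance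

instance haarUnitary_isProbabilityMeasure : IsProbabilityMeasure (haarUnitary n) :=
  ⟨by simpa [haarUnitary] using Measure.haarMeasure_self (G := Matrix.unitaryGroup n ℂ) (K₀ := ⊤)⟩

lemma continuous_twirlTwo (X : Matrix (n × n) (n × n) ℂ) (p q : n × n) :
    Continuous fun V : Matrix.unitaryGroup n ℂ => twirlTwo V X p q := by
  simp only [twirlTwo, Matrix.mul_apply, Matrix.kroneckerMap_apply, Matrix.conjTranspose_apply]
  have h : ∀ i j : n, Continuous fun V : Matrix.unitaryGroup n ℂ => (V : Matrix n n ℂ) i j :=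
    fun i j => (continuous_apply_apply i j).comp continuous_subtype_val
  refine continuous_finsetSum _ fun r _ => Continuous.mul (continuous_finsetSum _ fun s _ => ?_) ?_
  · exact ((h _ _).mul (h _ _)).mul continuous_const
  · exact (h _ _).star.mul (h _ _).star

lemma integrable_twirlTwo (X : Matrix (n × n) (n × n) ℂ) (p q : n × n) :
    Integrable (fun V => twirlTwo V X p q) (haarUnitary n) :=
  (continuous_twirlTwo X p q).integrable_of_hasCompactSupport (HasCompactSupport.of_compactSpace _)

lemma twirlTwo_mul (V W : Matrix.unitaryGroup n ℂ) (X : Matrix (n × n) (n × n) ℂ) :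
    twirlTwo (V * W) X = ((V : Matrix n n ℂ) ⊗ₖ (V : Matrix n n ℂ)) * twirlTwo W X *
      ((V : Matrix n n ℂ).conjTranspose ⊗ₖ (V : Matrix n n ℂ).conjTranspose) := by
  simp only [twirlTwo, Submonoid.coe_mul, Matrix.conjTranspose_mul, Matrix.mul_kronecker_mul,
    mul_assoc]

/-- Left invariance of the Haar measure makes the Haar average of `V^{⊗2} X (V†)^{⊗2}` commute with
every `V ⊗ V`. -/
lemma haar_twirlTwo_commute (X : Matrix (n × n) (n × n) ℂ) {V : Matrix n n ℂ}
    (hV : V ∈ Matrix.unitaryGroup n ℂ) :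
    (V ⊗ₖ V) * (Matrix.of fun p q => ∫ W, twirlTwo W X p q ∂(haarUnitary n)) =
      (Matrix.of fun p q => ∫ W, twirlTwo W X p q ∂(haarUnitary n)) * (V ⊗ₖ V) := by
  set T : Matrix (n × n) (n × n) ℂ := Matrix.of fun p q => ∫ W, twirlTwo W X p q ∂(haarUnitary n)
    with hT
  have hVV : (V.conjTranspose ⊗ₖ V.conjTranspose) * (V ⊗ₖ V) = 1 := by
    rw [← Matrix.mul_kronecker_mul, ← Matrix.star_eq_conjTranspose,
      Matrix.mem_unitaryGroup_iff'.mp hV, Matrix.one_kronecker_one]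
  have hinv : (V ⊗ₖ V) * T * (V.conjTranspose ⊗ₖ V.conjTranspose) = T := by
    ext p q
    have h1 : T p q = ∫ W, twirlTwo (⟨V, hV⟩ * W) X p q ∂(haarUnitary n) :=
      (integral_mul_left_eq_self (fun W => twirlTwo W X p q) _).symm
    rw [h1]
    simp only [twirlTwo_mul]
    simp only [Matrix.mul_apply, hT, Matrix.of_apply]
    rw [integral_finsetSum _ fun r _ => ?_]
    · refine Finset.sum_congr rfl fun r _ => ?_
      rw [integral_mul_const, integral_finsetSum _ fun s _ => ?_]
      · simp only [integral_const_mul]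
      · exact (integrable_twirlTwo X s r).const_mul _
    · refine Integrable.mul_const ?_ _
      exact integrable_finsetSum _ fun s _ => (integrable_twirlTwo X s r).const_mul _
  calc (V ⊗ₖ V) * T = (V ⊗ₖ V) * T * ((V.conjTranspose ⊗ₖ V.conjTranspose) * (V ⊗ₖ V)) := by
        rw [hVV, mul_one]
    _ = T * (V ⊗ₖ V) := by rw [← mul_assoc, hinv]

end Twirl

/-! ### Second moments of a unitary 2-design -/

section Moments

variable {M L D : Type*} [Fintype M] [Fintype L] [Fintype D]
  [DecidableEq M] [DecidableEq L]

lemma IsUnitaryTwoDesign.nonempty {n : Type*} [Fintype n] [DecidableEq n] [Nonempty n]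
    {U : D → Matrix.unitaryGroup n ℂ} (hU : IsUnitaryTwoDesign U) : Nonempty D := by
  by_contra h
  rw [not_nonempty_iff] at h
  obtain ⟨x⟩ := ‹Nonempty n›
  have h1 : ∀ V : Matrix.unitaryGroup n ℂ, twirlTwo V 1 = 1 := fun V => by
    rw [twirlTwo, mul_one, ← Matrix.mul_kronecker_mul, ← Matrix.star_eq_conjTranspose,
      Matrix.mem_unitaryGroup_iff.mp V.2, Matrix.one_kronecker_one]
  have := congrFun (congrFun (hU 1) (x, x)) (x, x)
  simp [h1] at this

lemma IsUnitaryTwoDesign.exists_average_eq {n : Type*} [Fintype n] [DecidableEq n]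
    {U : D → Matrix.unitaryGroup n ℂ} (hU : IsUnitaryTwoDesign U) (X : Matrix (n × n) (n × n) ℂ) :
    ∃ a b : ℂ, (Fintype.card D : ℂ)⁻¹ • ∑ i, twirlTwo (U i) X = a • 1 + b • swapMatrix n := by
  rw [hU X]
  exact commutant_eq fun V hV => haar_twirlTwo_commute X hV

/-- The operator that swaps the two copies of `ℂ^M` in `(ℂ^M ⊗ ℂ^L) ⊗ (ℂ^M ⊗ ℂ^L)`. -/
def partialSwapMatrix (M L : Type*) [DecidableEq M] [DecidableEq L] :
    Matrix ((M × L) × (M × L)) ((M × L) × (M × L)) ℂ :=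
  Matrix.of fun p q =>
    if p.1.1 = q.2.1 ∧ p.2.1 = q.1.1 ∧ p.1.2 = q.1.2 ∧ p.2.2 = q.2.2 then 1 else 0

lemma trace_kronecker_mul_swapMatrix {n : Type*} [Fintype n] [DecidableEq n] (A B : Matrix n n ℂ) :
    ((A ⊗ₖ B) * swapMatrix n).trace = (A * B).trace := by
  simp [Matrix.trace, Matrix.mul_apply, swapMatrix, Fintype.sum_prod_type, ite_and]

/-- The trace of a product of marginals, as a linear functional of the tensor product. -/
lemma trace_kronecker_mul_partialSwapMatrix (A B : Matrix (M × L) (M × L) ℂ) :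
    ((A ⊗ₖ B) * partialSwapMatrix M L).trace = (marginalFst A * marginalFst B).trace := by
  simp [Matrix.trace, Matrix.mul_apply, partialSwapMatrix, Fintype.sum_prod_type, ite_and,
    marginalFst, Finset.sum_mul_sum]
  refine Finset.sum_congr rfl fun _ _ => Finset.sum_comm

lemma trace_partialSwapMatrix :
    (partialSwapMatrix M L).trace = Fintype.card M * (Fintype.card L : ℂ) ^ 2 := by
  simp [Matrix.trace, partialSwapMatrix, Fintype.sum_prod_type, ite_and]
  ring

lemma trace_swapMatrix_mul_partialSwapMatrix :
    (swapMatrix (M × L) * partialSwapMatrix M L).trace =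
      (Fintype.card M : ℂ) ^ 2 * Fintype.card L := by
  simp [Matrix.trace, Matrix.mul_apply, swapMatrix, partialSwapMatrix, Fintype.sum_prod_type,
    ite_and]
  ring

lemma trace_swapMatrix {n : Type*} [Fintype n] [DecidableEq n] :
    (swapMatrix n).trace = Fintype.card n := by
  simp [Matrix.trace, swapMatrix, Fintype.sum_prod_type, ite_and]

lemma trace_swapMatrix_mul_self {n : Type*} [Fintype n] [DecidableEq n] :
    (swapMatrix n * swapMatrix n).trace = (Fintype.card n : ℂ) ^ 2 := by
  simp [Matrix.trace, Matrix.mul_apply, swapMatrix, Fintype.sum_prod_type, ite_and]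
  ring

lemma twirlTwo_kronecker {n : Type*} [Fintype n] [DecidableEq n] (V : Matrix.unitaryGroup n ℂ)
    (A B : Matrix n n ℂ) : twirlTwo V (A ⊗ₖ B) =
      ((V : Matrix n n ℂ) * A * (V : Matrix n n ℂ).conjTranspose) ⊗ₖ
        ((V : Matrix n n ℂ) * B * (V : Matrix n n ℂ).conjTranspose) := by
  simp only [twirlTwo, Matrix.mul_kronecker_mul]

lemma trace_unitary_conj {n : Type*} [Fintype n] [DecidableEq n] (V : Matrix.unitaryGroup n ℂ)
    (A : Matrix n n ℂ) :
    ((V : Matrix n n ℂ) * A * (V : Matrix n n ℂ).conjTranspose).trace = A.trace := by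
  rw [Matrix.trace_mul_comm, ← mul_assoc, ← Matrix.star_eq_conjTranspose,
    Matrix.mem_unitaryGroup_iff'.mp V.2, one_mul]

lemma unitary_conj_mul {n : Type*} [Fintype n] [DecidableEq n] (V : Matrix.unitaryGroup n ℂ)
    (A B : Matrix n n ℂ) :
    ((V : Matrix n n ℂ) * A * (V : Matrix n n ℂ).conjTranspose) *
      ((V : Matrix n n ℂ) * B * (V : Matrix n n ℂ).conjTranspose) =
      (V : Matrix n n ℂ) * (A * B) * (V : Matrix n n ℂ).conjTranspose := by
  calc _ = (V : Matrix n n ℂ) * A * ((V : Matrix n n ℂ).conjTranspose * (V : Matrix n n ℂ)) * B *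
        (V : Matrix n n ℂ).conjTranspose := by simp only [mul_assoc]
    _ = _ := by
      rw [← Matrix.star_eq_conjTranspose, Matrix.mem_unitaryGroup_iff'.mp V.2]
      simp only [mul_assoc, one_mul]

/-- The average overlap of the marginals of `U_i A U_i†` and `U_i B U_i†`, in terms of the
coefficients `a`, `b` of the twirl `a 1 + b F` of `A ⊗ B`. These are determined by the two linear
equations obtained from pairing the twirl with `1` and with the swap `F`. -/
theorem exists_average_trace_marginalFst_mul [Nonempty M] [Nonempty L]
    {U : D → Matrix.unitaryGroup (M × L) ℂ} (hU : IsUnitaryTwoDesign U)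
    (A B : Matrix (M × L) (M × L) ℂ) :
    ∃ a b : ℂ,
      a * (Fintype.card (M × L) : ℂ) ^ 2 + b * Fintype.card (M × L) = A.trace * B.trace ∧
      a * (Fintype.card (M × L) : ℂ) + b * (Fintype.card (M × L) : ℂ) ^ 2 = (A * B).trace ∧
      (Fintype.card D : ℂ)⁻¹ * ∑ i,
        (marginalFst ((U i : Matrix (M × L) (M × L) ℂ) * A *
            (U i : Matrix (M × L) (M × L) ℂ).conjTranspose) *
          marginalFst ((U i : Matrix (M × L) (M × L) ℂ) * B *
            (U i : Matrix (M × L) (M × L) ℂ).conjTranspose)).trace =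
        a * (Fintype.card M * (Fintype.card L : ℂ) ^ 2) +
          b * ((Fintype.card M : ℂ) ^ 2 * Fintype.card L) := by
  have := hU.nonempty
  have hD : (Fintype.card D : ℂ) ≠ 0 := Nat.cast_ne_zero.mpr Fintype.card_ne_zero
  obtain ⟨a, b, hab⟩ := hU.exists_average_eq (A ⊗ₖ B)
  have pair : ∀ G : Matrix ((M × L) × (M × L)) ((M × L) × (M × L)) ℂ,
      (Fintype.card D : ℂ)⁻¹ * ∑ i, (twirlTwo (U i) (A ⊗ₖ B) * G).trace =
        a * G.trace + b * (swapMatrix (M × L) * G).trace := by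
    intro G
    have h := congrArg (fun Y => (Y * G).trace) hab
    simpa [Matrix.smul_mul, Matrix.sum_mul, Matrix.trace_sum, Matrix.add_mul, Matrix.trace_smul,
      Matrix.trace_add] using h
  refine ⟨a, b, ?_, ?_, ?_⟩
  · have h := pair 1
    simp only [mul_one, twirlTwo_kronecker, Matrix.trace_kronecker, trace_unitary_conj,
      Finset.sum_const, Finset.card_univ, nsmul_eq_mul, trace_swapMatrix, Matrix.trace_one,
      Fintype.card_prod (M × L) (M × L), Nat.cast_mul] at h
    rw [inv_mul_cancel_left₀ hD] at h
    rw [h]; ring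
  · have h := pair (swapMatrix (M × L))
    simp only [twirlTwo_kronecker, trace_kronecker_mul_swapMatrix, unitary_conj_mul,
      trace_unitary_conj, Finset.sum_const, Finset.card_univ, nsmul_eq_mul, trace_swapMatrix,
      trace_swapMatrix_mul_self] at h
    rw [inv_mul_cancel_left₀ hD] at h
    exact h.symm
  · have h := pair (partialSwapMatrix M L)
    simpa only [twirlTwo_kronecker, trace_kronecker_mul_partialSwapMatrix, trace_partialSwapMatrix,
      trace_swapMatrix_mul_partialSwapMatrix] using h

end Moments

/-! ### Collision bounds for the output of the design -/

section Collision

/-- The coefficient of the error term, `b N + a m²` with `N = m l`, is affine in `m²`, and it is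
nonnegative at `m² = 1` and at `m² = N²` by the two hypotheses. -/
lemma collision_bound_of_coefficients {m l a b : ℝ} (hm : 1 ≤ m) (hl : 1 ≤ l)
    (hA : 0 ≤ a * (m * l) ^ 2 + b * (m * l)) (hP : 0 ≤ a * (m * l) + b * (m * l) ^ 2) :
    m * (a * (m * l ^ 2) + b * (m ^ 2 * l)) ≤
      (a * (m * l) ^ 2 + b * (m * l)) + m / l * (a * (m * l) + b * (m * l) ^ 2) := by
  have hm0 : 0 < m := by linarith
  have hl0 : 0 < l := by linarith
  have hP' : 0 ≤ a + b * (m * l) := by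
    have : 0 ≤ (m * l) * (a + b * (m * l)) := by linarith
    exact nonneg_of_mul_nonneg_right this (by positivity)
  have hkey : 0 ≤ b * (m * l) + a * m ^ 2 := by
    rcases le_total 0 a with ha | ha
    · nlinarith [mul_nonneg ha (show 0 ≤ m ^ 2 - 1 by nlinarith)]
    · have h1 : m ^ 2 ≤ (m * l) ^ 2 := by
        rw [mul_pow]
        exact le_mul_of_one_le_right (by positivity) (by nlinarith)
      nlinarith [mul_le_mul_of_nonpos_left h1 ha]
  have e : (a * (m * l) ^ 2 + b * (m * l)) + m / l * (a * (m * l) + b * (m * l) ^ 2) -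
      m * (a * (m * l ^ 2) + b * (m ^ 2 * l)) = b * (m * l) + a * m ^ 2 := by
    field_simp
    ring
  linarith

variable {M L D R : Type*} [Fintype M] [Fintype L] [Fintype D] [Fintype R]
  [DecidableEq M] [DecidableEq L] [DecidableEq R]

lemma trace_mul_self_re_nonneg {n : Type*} [Fintype n] {X : Matrix n n ℂ} (hX : X.IsHermitian) :
    0 ≤ (X * X).trace.re := by
  have h := (Matrix.posSemidef_conjTranspose_mul_self X).trace_nonneg
  rw [hX.eq] at h
  exact (Complex.le_def.mp h).1

/-- The operator `(1 ⊗ ⟨r|) X (1 ⊗ |r'⟩)`. -/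
def block {N : Type*} (X : Matrix (N × R) (N × R) ℂ) (r r' : R) : Matrix N N ℂ :=
  Matrix.of fun a a' => X (a, r) (a', r')

omit [DecidableEq R] in
lemma trace_mul_eq_sum_block {N : Type*} [Fintype N] (X Y : Matrix (N × R) (N × R) ℂ) :
    (X * Y).trace = ∑ p : R × R, (block X p.1 p.2 * block Y p.2 p.1).trace := by
  simp only [Matrix.trace, Matrix.diag_apply, Matrix.mul_apply, block, Matrix.of_apply,
    Fintype.sum_prod_type]
  rw [Finset.sum_comm]
  refine Finset.sum_congr rfl fun r _ => ?_
  conv_rhs => rw [Finset.sum_comm]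
  exact Finset.sum_congr rfl fun a _ => Finset.sum_comm

omit [Fintype R] [DecidableEq R] in
lemma trace_block {N : Type*} [Fintype N] (X : Matrix (N × R) (N × R) ℂ) (r r' : R) :
    (block X r r').trace = marginalSnd X r r' := rfl

lemma block_kronecker_one_mul_mul {N : Type*} [Fintype N] (V W : Matrix N N ℂ)
    (X : Matrix (N × R) (N × R) ℂ) (r r' : R) :
    block ((V ⊗ₖ (1 : Matrix R R ℂ)) * X * (W ⊗ₖ (1 : Matrix R R ℂ))) r r' =
      V * block X r r' * W := by
  ext a a'
  simp [block, Matrix.mul_apply, Fintype.sum_prod_type, Matrix.one_apply]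

omit [Fintype M] [Fintype R] [DecidableEq M] [DecidableEq L] [DecidableEq R] in
lemma block_traceMiddle (X : Matrix ((M × L) × R) ((M × L) × R) ℂ) (r r' : R) :
    block (traceMiddle X) r r' = marginalFst (block X r r') := rfl

/-- The averaged purity of the outputs `tr_L[U_i X U_i†]` for an operator `X` with side
information `R`. -/
theorem average_purity_traceMiddle_le [Nonempty M] [Nonempty L]
    {U : D → Matrix.unitaryGroup (M × L) ℂ} (hU : IsUnitaryTwoDesign U)
    {X : Matrix ((M × L) × R) ((M × L) × R) ℂ} (hX : X.IsHermitian)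
    (hXR : (marginalSnd X).IsHermitian) {Z : D → Matrix (M × R) (M × R) ℂ}
    (hZ : ∀ i, Z i = traceMiddle (((U i : Matrix (M × L) (M × L) ℂ) ⊗ₖ (1 : Matrix R R ℂ)) * X *
      ((U i : Matrix (M × L) (M × L) ℂ) ⊗ₖ (1 : Matrix R R ℂ)).conjTranspose)) :
    Fintype.card M * ((Fintype.card D : ℝ)⁻¹ * ∑ i, (Z i * Z i).trace.re) ≤
      (marginalSnd X * marginalSnd X).trace.re +
        (Fintype.card M / Fintype.card L : ℝ) * (X * X).trace.re := by
  choose a b hA hP hav using fun p : R × R =>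
    exists_average_trace_marginalFst_mul hU (block X p.1 p.2) (block X p.2 p.1)
  have hA' : (marginalSnd X * marginalSnd X).trace =
      (∑ p, a p) * (Fintype.card (M × L) : ℂ) ^ 2 + (∑ p, b p) * Fintype.card (M × L) := by
    simp only [Finset.sum_mul, ← Finset.sum_add_distrib, hA, trace_block]
    simp [Matrix.trace, Matrix.mul_apply, Fintype.sum_prod_type]
  have hP' : (X * X).trace =
      (∑ p, a p) * (Fintype.card (M × L) : ℂ) + (∑ p, b p) * (Fintype.card (M × L) : ℂ) ^ 2 := by
    simp only [Finset.sum_mul, ← Finset.sum_add_distrib, hP, trace_mul_eq_sum_block X X]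
  have hav' : (Fintype.card D : ℂ)⁻¹ * ∑ i, (Z i * Z i).trace =
      (∑ p, a p) * (Fintype.card M * (Fintype.card L : ℂ) ^ 2) +
        (∑ p, b p) * ((Fintype.card M : ℂ) ^ 2 * Fintype.card L) := by
    simp only [Finset.sum_mul, ← Finset.sum_add_distrib, ← hav, trace_mul_eq_sum_block (Z _) (Z _)]
    rw [Finset.sum_comm, Finset.mul_sum]
    simp only [hZ, block_traceMiddle, Matrix.conjTranspose_kronecker, Matrix.conjTranspose_one,
      block_kronecker_one_mul_mul]
  have reA := congrArg Complex.re hA'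
  have reP := congrArg Complex.re hP'
  have reav := congrArg Complex.re hav'
  have hre : ∀ (z : ℂ) (r : ℝ), (z * (r : ℂ)).re = z.re * r := Complex.re_mul_ofReal
  have c1 : ((Fintype.card (M × L) : ℂ)) = (((Fintype.card M : ℝ) * Fintype.card L : ℝ) : ℂ) := by
    push_cast [Fintype.card_prod]; rfl
  have c2 : (Fintype.card M * (Fintype.card L : ℂ) ^ 2) =
      (((Fintype.card M : ℝ) * (Fintype.card L : ℝ) ^ 2 : ℝ) : ℂ) := by push_cast; rfl
  have c3 : ((Fintype.card M : ℂ) ^ 2 * Fintype.card L) =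
      (((Fintype.card M : ℝ) ^ 2 * (Fintype.card L : ℝ) : ℝ) : ℂ) := by push_cast; rfl
  have c4 : (Fintype.card D : ℂ)⁻¹ = (((Fintype.card D : ℝ)⁻¹ : ℝ) : ℂ) := by push_cast; rfl
  rw [c1, ← Complex.ofReal_pow, Complex.add_re, hre, hre] at reA reP
  rw [c2, c3, c4, Complex.add_re, hre, hre, Complex.re_ofReal_mul, Complex.re_sum] at reav
  have hm : (1 : ℝ) ≤ Fintype.card M := Nat.one_le_cast.mpr Fintype.card_pos
  have hl : (1 : ℝ) ≤ Fintype.card L := Nat.one_le_cast.mpr Fintype.card_pos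
  rw [reav, reA, reP]
  exact collision_bound_of_coefficients hm hl (reA ▸ trace_mul_self_re_nonneg hXR)
    (reP ▸ trace_mul_self_re_nonneg hX)

end Collision

/-! ### A weighted Hilbert–Schmidt bound on the trace norm -/

section TraceNorm

variable {n : Type*} [Fintype n]

/-- The Cauchy–Schwarz inequality for the Hilbert–Schmidt inner product. -/
lemma trace_conjTranspose_mul_re_sq_le (A B : Matrix n n ℂ) :
    (A.conjTranspose * B).trace.re ^ 2 ≤
      (A.conjTranspose * A).trace.re * (B.conjTranspose * B).trace.re := by
  have hBA : (B.conjTranspose * A).trace.re = (A.conjTranspose * B).trace.re := by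
    rw [← Matrix.conjTranspose_conjTranspose A, ← Matrix.conjTranspose_mul,
      Matrix.trace_conjTranspose, Matrix.conjTranspose_conjTranspose, Complex.star_def,
      Complex.conj_re]
  have h : ∀ t : ℝ, 0 ≤ (B.conjTranspose * B).trace.re * (t * t) +
      (2 * (A.conjTranspose * B).trace.re) * t + (A.conjTranspose * A).trace.re := by
    intro t
    have h1 := (Matrix.posSemidef_conjTranspose_mul_self (A + (t : ℂ) • B)).trace_nonneg
    have h2 := (Complex.le_def.mp h1).1
    simp only [Matrix.conjTranspose_add, Matrix.conjTranspose_smul, add_mul, mul_add,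
      Matrix.smul_mul, Matrix.mul_smul, Matrix.trace_add, Matrix.trace_smul, Complex.star_def,
      Complex.conj_ofReal, smul_eq_mul, Complex.add_re, Complex.re_ofReal_mul, hBA,
      Complex.zero_re] at h2
    linarith
  have := discrim_le_zero h
  unfold discrim at this
  linarith

variable [DecidableEq n]

/-- The unitary part of a Hermitian matrix in its polar decomposition. -/
lemma exists_sign_mul_eq_abs {X : Matrix n n ℂ} (hX : X.IsHermitian) :
    ∃ S : Matrix n n ℂ, S.IsHermitian ∧ S * S = 1 ∧ S * X = CFC.abs X := by
  -- `S` is the sign function of `X`, which is continuous on the finite spectrum.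
  have hfin : (spectrum ℝ X).Finite := Matrix.finite_real_spectrum
  have hc : ∀ f : ℝ → ℝ, ContinuousOn f (spectrum ℝ X) := fun f => hfin.continuousOn f
  have hsa : IsSelfAdjoint X := hX
  refine ⟨cfc (fun x : ℝ => if 0 ≤ x then (1 : ℝ) else -1) X, ?_, ?_, ?_⟩
  · exact cfc_predicate (p := IsSelfAdjoint) _ X
  · rw [← cfc_mul _ _ X (hc _) (hc _), ← cfc_one ℝ X]
    refine cfc_congr fun x _ => ?_
    by_cases h : 0 ≤ x <;> simp [h]
  · conv_lhs => enter [2]; rw [← cfc_id' ℝ X]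
    rw [← cfc_mul _ _ X (hc _) (hc _), CFC.abs_eq_cfc_norm X]
    refine cfc_congr fun x _ => ?_
    by_cases h : 0 ≤ x
    · simp [h, abs_of_nonneg]
    · simp [h, abs_of_neg (not_le.mp h)]

/-- With the weight `W = T⁴` and `K = T⁻¹`, this is
`‖X‖₁² ≤ tr[W] tr[(W^{-1/4} X W^{-1/4})²]`. -/
theorem traceNorm_sq_le {X T K : Matrix n n ℂ} (hX : X.IsHermitian) (hT : T.IsHermitian)
    (hK : K.IsHermitian) (hTK : T * K = 1) :
    traceNorm X ^ 2 ≤ (T * T * (T * T)).trace.re * (K * X * K * (K * X * K)).trace.re := by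
  obtain ⟨S, hS, hSS, hSX⟩ := exists_sign_mul_eq_abs hX
  have hKT : K * T = 1 := mul_eq_one_comm.mp hTK
  have hTST : (T * S * T).IsHermitian := by
    rw [Matrix.IsHermitian, Matrix.conjTranspose_mul, Matrix.conjTranspose_mul, hT.eq, hS.eq,
      mul_assoc]
  have hKXK : (K * X * K).IsHermitian := by
    rw [Matrix.IsHermitian, Matrix.conjTranspose_mul, Matrix.conjTranspose_mul, hK.eq, hX.eq,
      mul_assoc]
  have hTT : (T * T).IsHermitian := by rw [Matrix.IsHermitian, Matrix.conjTranspose_mul, hT.eq]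
  have hSTTS : (S * (T * T) * S).IsHermitian := by
    rw [Matrix.IsHermitian, Matrix.conjTranspose_mul, Matrix.conjTranspose_mul, hTT.eq, hS.eq,
      ← mul_assoc S]
  have e1 : (T * S * T * (K * X * K)).trace = (CFC.abs X).trace := by
    calc (T * S * T * (K * X * K)).trace = (T * (S * (T * K) * X * K)).trace := by
          simp only [mul_assoc]
      _ = (S * (T * K) * X * (K * T)).trace := by rw [Matrix.trace_mul_comm, mul_assoc _ K T]
      _ = (CFC.abs X).trace := by rw [hTK, hKT, mul_one, mul_one, hSX]
  have e2 : (T * S * T * (T * S * T)).trace = (T * T * (S * (T * T) * S)).trace := by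
    calc (T * S * T * (T * S * T)).trace = (T * (S * (T * T) * S * T)).trace := by
          simp only [mul_assoc]
      _ = (T * T * (S * (T * T) * S)).trace := by
          rw [Matrix.trace_mul_comm, mul_assoc _ T T, Matrix.trace_mul_comm]
  have e3 : (S * (T * T) * S * (S * (T * T) * S)).trace = (T * T * (T * T)).trace := by
    calc (S * (T * T) * S * (S * (T * T) * S)).trace
        = (S * (T * T * (S * S) * (T * T) * S)).trace := by simp only [mul_assoc]
      _ = (T * T * (S * S) * (T * T) * (S * S)).trace := by
          rw [Matrix.trace_mul_comm, mul_assoc _ S S]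
      _ = (T * T * (T * T)).trace := by rw [hSS, mul_one, mul_one]
  have c1 := trace_conjTranspose_mul_re_sq_le (T * S * T) (K * X * K)
  -- The second inequality bounds `tr[T S T² S T]` by `tr[T⁴]`.
  have c2 := trace_conjTranspose_mul_re_sq_le (T * T) (S * (T * T) * S)
  rw [hTST.eq, hKXK.eq, e1, e2] at c1
  rw [hTT.eq, hSTTS.eq, e3, ← sq (T * T * (T * T)).trace.re] at c2
  have c3 := abs_le_of_sq_le_sq' c2 (trace_mul_self_re_nonneg hTT)
  exact c1.trans (mul_le_mul_of_nonneg_right c3.2 (trace_mul_self_re_nonneg hKXK))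

lemma exists_fourth_root {σ : Matrix n n ℂ} (hσ : σ.PosDef) :
    ∃ T K : Matrix n n ℂ, T.IsHermitian ∧ K.IsHermitian ∧ T * K = 1 ∧ T * T * (T * T) = σ := by
  have h0 : 0 ≤ σ := hσ.posSemidef.nonneg
  set T := CFC.sqrt (CFC.sqrt σ)
  have hT : T.PosSemidef := Matrix.nonneg_iff_posSemidef.mp (CFC.sqrt_nonneg _)
  have hTT : T * T * (T * T) = σ := by
    rw [CFC.sqrt_mul_sqrt_self (CFC.sqrt σ) (CFC.sqrt_nonneg σ), CFC.sqrt_mul_sqrt_self σ h0]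
  have hu : IsUnit T := by
    have : IsUnit (T * (T * (T * T))) := by rw [← mul_assoc, hTT]; exact hσ.isUnit
    exact isUnit_of_mul_isUnit_left this
  exact ⟨T, T⁻¹, hT.isHermitian, hT.isHermitian.inv, Matrix.mul_nonsing_inv _
    ((Matrix.isUnit_iff_isUnit_det _).mp hu), hTT⟩

lemma trace_mul_re_nonneg_of_posSemidef {A B : Matrix n n ℂ} (hA : A.PosSemidef)
    (hB : B.PosSemidef) : 0 ≤ (A * B).trace.re := by
  have hs : (CFC.sqrt A).PosSemidef := Matrix.nonneg_iff_posSemidef.mp (CFC.sqrt_nonneg A)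
  have h := (hB.conjTranspose_mul_mul_same (CFC.sqrt A)).trace_nonneg
  rw [hs.isHermitian.eq, Matrix.trace_mul_comm, ← mul_assoc,
    CFC.sqrt_mul_sqrt_self A hA.nonneg] at h
  exact (Complex.le_def.mp h).1

end TraceNorm

/-! ### Decoupling from quantum side information -/

section Decoupling

variable {A B : Type*} [Fintype A] [Fintype B] [DecidableEq A]

lemma trace_mul_one_kronecker (X : Matrix (A × B) (A × B) ℂ) (Y : Matrix B B ℂ) :
    (X * ((1 : Matrix A A ℂ) ⊗ₖ Y)).trace = (marginalSnd X * Y).trace := by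
  simp [Matrix.trace, Matrix.mul_apply, marginalSnd, Fintype.sum_prod_type, Matrix.one_apply,
    Finset.sum_mul]
  rw [Finset.sum_comm]
  exact Finset.sum_congr rfl fun b _ => Finset.sum_comm

omit [Fintype B] in
lemma marginalSnd_one_kronecker (Y : Matrix B B ℂ) :
    marginalSnd ((1 : Matrix A A ℂ) ⊗ₖ Y) = (Fintype.card A : ℂ) • Y := by
  ext b b'
  simp [marginalSnd]

lemma marginalSnd_one_kronecker_conj (X : Matrix (A × B) (A × B) ℂ) (K : Matrix B B ℂ) :
    marginalSnd (((1 : Matrix A A ℂ) ⊗ₖ K) * X * ((1 : Matrix A A ℂ) ⊗ₖ K)) =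
      K * marginalSnd X * K := by
  ext b b'
  simp [marginalSnd, Matrix.mul_apply, Fintype.sum_prod_type, Matrix.one_apply]
  simp only [Finset.sum_mul, Finset.mul_sum]
  rw [Finset.sum_comm]
  exact Finset.sum_congr rfl fun b _ => Finset.sum_comm

omit [Fintype B] [DecidableEq A] in
lemma marginalSnd_isHermitian {X : Matrix (A × B) (A × B) ℂ} (hX : X.IsHermitian) :
    (marginalSnd X).IsHermitian := by
  ext b b'
  simp only [marginalSnd, Matrix.conjTranspose_apply, Matrix.of_apply, star_sum]
  exact Finset.sum_congr rfl fun a _ => hX.apply _ _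

/-- Subtracting the product of the maximally mixed state with the marginal leaves the purity
reduced by the purity of that product. -/
lemma trace_sub_mixed_sq [Nonempty A] (X : Matrix (A × B) (A × B) ℂ) :
    ((X - ((Fintype.card A : ℂ)⁻¹ • (1 : Matrix A A ℂ)) ⊗ₖ marginalSnd X) *
      (X - ((Fintype.card A : ℂ)⁻¹ • (1 : Matrix A A ℂ)) ⊗ₖ marginalSnd X)).trace =
      (X * X).trace - (Fintype.card A : ℂ)⁻¹ * (marginalSnd X * marginalSnd X).trace := by
  have hA : (Fintype.card A : ℂ) ≠ 0 := Nat.cast_ne_zero.mpr Fintype.card_ne_zero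
  rw [Matrix.smul_kronecker]
  simp only [sub_mul, mul_sub, Matrix.trace_sub, Matrix.mul_smul, Matrix.smul_mul,
    Matrix.trace_smul, trace_mul_one_kronecker, smul_eq_mul, marginalSnd_one_kronecker]
  rw [Matrix.trace_mul_comm (1 ⊗ₖ marginalSnd X), trace_mul_one_kronecker]
  field_simp
  ring

variable {M L D R : Type*} [Fintype M] [Fintype L] [Fintype D] [Fintype R]
  [DecidableEq M] [DecidableEq L] [DecidableEq D] [DecidableEq R]

omit [DecidableEq R] in
lemma traceMiddle_one_kronecker_conj (X : Matrix ((M × L) × R) ((M × L) × R) ℂ)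
    (K : Matrix R R ℂ) :
    traceMiddle (((1 : Matrix (M × L) (M × L) ℂ) ⊗ₖ K) * X *
        ((1 : Matrix (M × L) (M × L) ℂ) ⊗ₖ K)) =
      ((1 : Matrix M M ℂ) ⊗ₖ K) * traceMiddle X * ((1 : Matrix M M ℂ) ⊗ₖ K) := by
  ext ⟨m, r⟩ ⟨m', r'⟩
  simp [traceMiddle, Matrix.mul_apply, Fintype.sum_prod_type, Matrix.one_apply]
  simp only [Finset.sum_mul, Finset.mul_sum]
  rw [Finset.sum_comm]
  exact Finset.sum_congr rfl fun b _ => Finset.sum_comm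

omit [DecidableEq M] [DecidableEq L] [Fintype R] [DecidableEq R] in
lemma marginalSnd_traceMiddle (X : Matrix ((M × L) × R) ((M × L) × R) ℂ) :
    marginalSnd (traceMiddle X) = marginalSnd X := by
  ext r r'
  simp [marginalSnd, traceMiddle, Fintype.sum_prod_type]

/-- The output of the channel `X ↦ tr_L[(V ⊗ 1_R) X (V ⊗ 1_R)†]`. -/
def rotatedMarginal (V : Matrix.unitaryGroup (M × L) ℂ)
    (X : Matrix ((M × L) × R) ((M × L) × R) ℂ) : Matrix (M × R) (M × R) ℂ :=
  traceMiddle (((V : Matrix (M × L) (M × L) ℂ) ⊗ₖ (1 : Matrix R R ℂ)) * X *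
    ((V : Matrix (M × L) (M × L) ℂ) ⊗ₖ (1 : Matrix R R ℂ)).conjTranspose)

lemma marginalSnd_rotatedMarginal (V : Matrix.unitaryGroup (M × L) ℂ)
    (X : Matrix ((M × L) × R) ((M × L) × R) ℂ) :
    marginalSnd (rotatedMarginal V X) = marginalSnd X := by
  rw [rotatedMarginal, marginalSnd_traceMiddle, Matrix.conjTranspose_kronecker,
    Matrix.conjTranspose_one]
  ext r r'
  rw [← trace_block, block_kronecker_one_mul_mul, trace_unitary_conj, trace_block]

lemma rotatedMarginal_isHermitian (V : Matrix.unitaryGroup (M × L) ℂ)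
    {X : Matrix ((M × L) × R) ((M × L) × R) ℂ} (hX : X.IsHermitian) :
    (rotatedMarginal V X).IsHermitian := by
  have h := Matrix.isHermitian_mul_mul_conjTranspose
    ((V : Matrix (M × L) (M × L) ℂ) ⊗ₖ (1 : Matrix R R ℂ)) hX
  ext p q
  simp only [rotatedMarginal, traceMiddle, Matrix.conjTranspose_apply, Matrix.of_apply, star_sum]
  exact Finset.sum_congr rfl fun l _ => h.apply _ _

lemma rotatedMarginal_one_kronecker_conj (V : Matrix.unitaryGroup (M × L) ℂ)
    (X : Matrix ((M × L) × R) ((M × L) × R) ℂ) (K : Matrix R R ℂ) :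
    rotatedMarginal V (((1 : Matrix (M × L) (M × L) ℂ) ⊗ₖ K) * X *
        ((1 : Matrix (M × L) (M × L) ℂ) ⊗ₖ K)) =
      ((1 : Matrix M M ℂ) ⊗ₖ K) * rotatedMarginal V X * ((1 : Matrix M M ℂ) ⊗ₖ K) := by
  have h1 : ∀ W : Matrix (M × L) (M × L) ℂ, (W ⊗ₖ (1 : Matrix R R ℂ)) * (1 ⊗ₖ K) =
      (1 ⊗ₖ K) * (W ⊗ₖ (1 : Matrix R R ℂ)) := fun W => by
    rw [← Matrix.mul_kronecker_mul, ← Matrix.mul_kronecker_mul, one_mul, one_mul, mul_one, mul_one]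
  rw [rotatedMarginal, rotatedMarginal, ← traceMiddle_one_kronecker_conj,
    Matrix.conjTranspose_kronecker, Matrix.conjTranspose_one]
  congr 1
  simp only [mul_assoc]
  rw [← h1, ← mul_assoc _ (1 ⊗ₖ K), h1]
  simp only [mul_assoc]

lemma sum_basisProj : ∑ i : D, basisProj i = (1 : Matrix D D ℂ) := by
  ext i j
  simp [basisProj, Matrix.sum_apply, Matrix.single_apply, Matrix.one_apply, ite_and]

/-- The deviation of the extractor output from the ideal output is block diagonal in `D`. -/
lemma extractorOutputQSI_sub_eq (U : D → Matrix.unitaryGroup (M × L) ℂ)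
    (X : Matrix ((M × L) × R) ((M × L) × R) ℂ) (C : Matrix (M × R) (M × R) ℂ) :
    extractorOutputQSI U X - C ⊗ₖ ((Fintype.card D : ℂ)⁻¹ • (1 : Matrix D D ℂ)) =
      (Fintype.card D : ℂ)⁻¹ • ∑ i, (rotatedMarginal (U i) X - C) ⊗ₖ basisProj i := by
  have : C ⊗ₖ ((Fintype.card D : ℂ)⁻¹ • (1 : Matrix D D ℂ)) =
      (Fintype.card D : ℂ)⁻¹ • ∑ i, C ⊗ₖ basisProj i := by
    rw [← sum_basisProj, Matrix.kronecker_smul]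
    congr 1
    ext p q
    simp [Matrix.sum_apply, Matrix.kroneckerMap_apply, Finset.mul_sum]
  rw [this, extractorOutputQSI, ← smul_sub, ← Finset.sum_sub_distrib]
  congr 1
  ext p q
  simp [rotatedMarginal, Matrix.sum_apply, sub_mul]

lemma trace_blockDiagonal_mul_self {n : Type*} [Fintype n] (Y : D → Matrix n n ℂ) :
    ((∑ i, Y i ⊗ₖ basisProj i) * ∑ i, Y i ⊗ₖ basisProj i).trace = ∑ i, (Y i * Y i).trace := by
  simp only [Finset.sum_mul, Finset.mul_sum, ← Matrix.mul_kronecker_mul, Matrix.trace_sum,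
    Matrix.trace_kronecker, basisProj]
  refine Finset.sum_congr rfl fun i _ => ?_
  rw [Finset.sum_eq_single i]
  · simp
  · intro j _ hj
    simp [Matrix.single_mul_single_of_ne, hj]
  · simp

/-- If `ρ ≤ c (1 ⊗ T⁴)` and `K = T⁻¹`, then the purity of `(1 ⊗ K) ρ (1 ⊗ K)` is at most
`c tr[ρ]`. -/
lemma trace_conj_sq_le {N : Type*} [Fintype N] [DecidableEq N]
    {ρ : Matrix (N × R) (N × R) ℂ} (hρ : ρ.PosSemidef) {T K : Matrix R R ℂ}
    (hK : K.IsHermitian) (hTK : T * K = 1) {c : ℝ}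
    (hc : ((c : ℂ) • ((1 : Matrix N N ℂ) ⊗ₖ (T * T * (T * T))) - ρ).PosSemidef) :
    ((((1 : Matrix N N ℂ) ⊗ₖ K) * ρ * ((1 : Matrix N N ℂ) ⊗ₖ K)) *
      (((1 : Matrix N N ℂ) ⊗ₖ K) * ρ * ((1 : Matrix N N ℂ) ⊗ₖ K))).trace.re ≤ c * ρ.trace.re := by
  set J : Matrix (N × R) (N × R) ℂ := (1 : Matrix N N ℂ) ⊗ₖ K with hJ
  have hKT : K * T = 1 := mul_eq_one_comm.mp hTK
  have hJJ : (J * J).IsHermitian := by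
    rw [hJ, ← Matrix.mul_kronecker_mul, Matrix.IsHermitian, Matrix.conjTranspose_kronecker,
      Matrix.conjTranspose_mul, Matrix.conjTranspose_mul, hK.eq, Matrix.conjTranspose_one]
  have h1 : J * J * ((1 : Matrix N N ℂ) ⊗ₖ (T * T * (T * T))) * (J * J) = 1 := by
    simp only [hJ, ← Matrix.mul_kronecker_mul, mul_one]
    have : K * K * (T * T * (T * T)) * (K * K) = 1 := by
      calc K * K * (T * T * (T * T)) * (K * K) = K * (K * T) * T * (T * (T * K) * K) := by
            simp only [mul_assoc]
        _ = (K * T) * (T * K) := by rw [hTK, hKT, mul_one, mul_one, hKT, hTK]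
        _ = 1 := by rw [hKT, hTK, mul_one]
    rw [this, Matrix.one_kronecker_one]
  have h2 := hc.conjTranspose_mul_mul_same (J * J)
  rw [hJJ.eq, mul_sub, sub_mul, Matrix.mul_smul, Matrix.smul_mul, h1] at h2
  have h3 := trace_mul_re_nonneg_of_posSemidef hρ h2
  rw [mul_sub, Matrix.trace_sub, Matrix.mul_smul, mul_one, Matrix.trace_smul, Complex.sub_re,
    smul_eq_mul, Complex.re_ofReal_mul] at h3
  have h4 : (J * ρ * J * (J * ρ * J)).trace = (ρ * (J * J * ρ * (J * J))).trace := by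
    calc (J * ρ * J * (J * ρ * J)).trace = (J * (ρ * J * (J * ρ * J))).trace := by
          simp only [mul_assoc]
      _ = (ρ * (J * J * ρ * (J * J))).trace := by
          rw [Matrix.trace_mul_comm]; simp only [mul_assoc]
  rw [h4]
  linarith

/-- The decoupling bound: if `ρ ≤ c (1 ⊗ T⁴)` with `T` invertible, then the squared trace distance
between the output of the design and the ideal output is at most `tr[T⁴] c tr[ρ] |M| / |L|`. -/
theorem traceNorm_extractorOutputQSI_sub_sq_le [Nonempty M] [Nonempty L]
    {U : D → Matrix.unitaryGroup (M × L) ℂ} (hU : IsUnitaryTwoDesign U)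
    {ρ : Matrix ((M × L) × R) ((M × L) × R) ℂ} (hρ : ρ.PosSemidef) {T K : Matrix R R ℂ}
    (hT : T.IsHermitian) (hK : K.IsHermitian) (hTK : T * K = 1) {c : ℝ}
    (hc : ((c : ℂ) • ((1 : Matrix (M × L) (M × L) ℂ) ⊗ₖ (T * T * (T * T))) - ρ).PosSemidef) :
    traceNorm (extractorOutputQSI U ρ -
      (((Fintype.card M : ℂ)⁻¹ • (1 : Matrix M M ℂ)) ⊗ₖ marginalSnd ρ) ⊗ₖ
        ((Fintype.card D : ℂ)⁻¹ • (1 : Matrix D D ℂ))) ^ 2 ≤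
      (T * T * (T * T)).trace.re * (Fintype.card M / Fintype.card L * (c * ρ.trace.re)) := by
  have := hU.nonempty
  rw [extractorOutputQSI_sub_eq]
  set J : Matrix ((M × L) × R) ((M × L) × R) ℂ := 1 ⊗ₖ K with hJ
  set ρ' := J * ρ * J with hρ'
  set Y : D → Matrix (M × R) (M × R) ℂ := fun i => rotatedMarginal (U i) ρ -
    ((Fintype.card M : ℂ)⁻¹ • (1 : Matrix M M ℂ)) ⊗ₖ marginalSnd ρ with hY
  set Z : D → Matrix (M × R) (M × R) ℂ := fun i => rotatedMarginal (U i) ρ' with hZ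
  set k : Matrix ((M × R) × D) ((M × R) × D) ℂ := ((1 : Matrix M M ℂ) ⊗ₖ K) ⊗ₖ 1 with hk
  set t : Matrix ((M × R) × D) ((M × R) × D) ℂ := ((1 : Matrix M M ℂ) ⊗ₖ T) ⊗ₖ 1 with ht
  have hJh : J.IsHermitian := by
    rw [hJ, Matrix.IsHermitian, Matrix.conjTranspose_kronecker, Matrix.conjTranspose_one, hK.eq]
  have hρ'h : ρ'.IsHermitian := by
    have := hρ.conjTranspose_mul_mul_same J
    rw [hJh.eq] at this
    exact this.isHermitian
  have hkh : k.IsHermitian := by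
    rw [hk, Matrix.IsHermitian, Matrix.conjTranspose_kronecker, Matrix.conjTranspose_kronecker,
      Matrix.conjTranspose_one, Matrix.conjTranspose_one, hK.eq]
  have hth : t.IsHermitian := by
    rw [ht, Matrix.IsHermitian, Matrix.conjTranspose_kronecker, Matrix.conjTranspose_kronecker,
      Matrix.conjTranspose_one, Matrix.conjTranspose_one, hT.eq]
  have htk : t * k = 1 := by
    simp only [ht, hk, ← Matrix.mul_kronecker_mul, hTK, one_mul, Matrix.one_kronecker_one]
  have htrace : (t * t * (t * t)).trace.re =
      (Fintype.card M * Fintype.card D : ℝ) * (T * T * (T * T)).trace.re := by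
    simp only [ht, ← Matrix.mul_kronecker_mul, one_mul, Matrix.trace_kronecker, Matrix.trace_one]
    rw [show (Fintype.card M : ℂ) * (T * T * (T * T)).trace * (Fintype.card D : ℂ) =
      ((Fintype.card M * Fintype.card D : ℝ) : ℂ) * (T * T * (T * T)).trace by push_cast; ring,
      Complex.re_ofReal_mul]
  have hYh : ((Fintype.card D : ℂ)⁻¹ • ∑ i, Y i ⊗ₖ basisProj i).IsHermitian := by
    have hC : (((Fintype.card M : ℂ)⁻¹ • (1 : Matrix M M ℂ)) ⊗ₖ marginalSnd ρ).IsHermitian := by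
      rw [Matrix.IsHermitian, Matrix.conjTranspose_kronecker, Matrix.conjTranspose_smul,
        Matrix.conjTranspose_one, (marginalSnd_isHermitian hρ.isHermitian).eq]
      simp
    rw [Matrix.IsHermitian, Matrix.conjTranspose_smul, Matrix.conjTranspose_sum]
    simp only [Matrix.conjTranspose_kronecker, hY, Matrix.conjTranspose_sub, hC.eq,
      (rotatedMarginal_isHermitian _ hρ.isHermitian).eq, basisProj, Matrix.conjTranspose_single]
    simp
  have hconj : k * ((Fintype.card D : ℂ)⁻¹ • ∑ i, Y i ⊗ₖ basisProj i) * k =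
      (Fintype.card D : ℂ)⁻¹ • ∑ i, (Z i - ((Fintype.card M : ℂ)⁻¹ • (1 : Matrix M M ℂ)) ⊗ₖ
        marginalSnd (Z i)) ⊗ₖ basisProj i := by
    rw [Matrix.mul_smul, Matrix.smul_mul, Finset.mul_sum, Finset.sum_mul]
    congr 1
    refine Finset.sum_congr rfl fun i _ => ?_
    rw [hk, ← Matrix.mul_kronecker_mul, ← Matrix.mul_kronecker_mul, one_mul, mul_one]
    congr 1
    simp only [hY, hZ, hρ', hJ, marginalSnd_rotatedMarginal, rotatedMarginal_one_kronecker_conj,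
      marginalSnd_one_kronecker_conj, mul_sub, sub_mul, ← Matrix.mul_kronecker_mul, one_mul,
      mul_one]
  have hmain := traceNorm_sq_le hYh hth hkh htk
  rw [hconj, htrace] at hmain
  refine hmain.trans ?_
  have hm : (0 : ℝ) < Fintype.card M := Nat.cast_pos.mpr Fintype.card_pos
  have hd : (0 : ℝ) < Fintype.card D := Nat.cast_pos.mpr Fintype.card_pos
  have hpur := average_purity_traceMiddle_le hU hρ'h (marginalSnd_isHermitian hρ'h)
    (Z := Z) fun i => rfl
  have hP := trace_conj_sq_le hρ hK hTK hc
  have hT4 : 0 ≤ (T * T * (T * T)).trace.re := by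
    refine trace_mul_self_re_nonneg ?_
    rw [Matrix.IsHermitian, Matrix.conjTranspose_mul, hT.eq]
  have hc4 : (Fintype.card D : ℂ)⁻¹ = (((Fintype.card D : ℝ)⁻¹ : ℝ) : ℂ) := by push_cast; rfl
  have hc5 : (Fintype.card M : ℂ)⁻¹ = (((Fintype.card M : ℝ)⁻¹ : ℝ) : ℂ) := by push_cast; rfl
  rw [Matrix.smul_mul, Matrix.mul_smul, Matrix.trace_smul, Matrix.trace_smul,
    trace_blockDiagonal_mul_self]
  have hmar : ∀ i, marginalSnd (Z i) = marginalSnd ρ' := fun i => marginalSnd_rotatedMarginal _ _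
  simp only [trace_sub_mixed_sq]
  simp only [hmar, Finset.sum_sub_distrib, Finset.sum_const, Finset.card_univ, smul_eq_mul,
    nsmul_eq_mul]
  rw [hc4, hc5, Complex.re_ofReal_mul, Complex.re_ofReal_mul, Complex.sub_re, Complex.re_sum,
    ← Complex.ofReal_natCast, Complex.re_ofReal_mul, Complex.re_ofReal_mul]
  have hP' := mul_le_mul_of_nonneg_left hP
    (show (0 : ℝ) ≤ Fintype.card M / Fintype.card L by positivity)
  calc _ = (T * T * (T * T)).trace.re * (Fintype.card M * ((Fintype.card D : ℝ)⁻¹ *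
          ∑ i, (Z i * Z i).trace.re) - (marginalSnd ρ' * marginalSnd ρ').trace.re) := by
        field_simp
    _ ≤ _ := mul_le_mul_of_nonneg_left (by linarith) hT4

end Decoupling

/-! ### Rényi 2-entropies -/

section Renyi

variable {M L D : Type*} [Fintype M] [Fintype L] [Fintype D]
  [DecidableEq M] [DecidableEq L] [DecidableEq D]

lemma rpow_smul_one {n : Type*} [Fintype n] [DecidableEq n] {t : ℝ} (ht : 0 ≤ t) (y : ℝ) :
    CFC.rpow ((t : ℂ) • (1 : Matrix n n ℂ)) y = ((t ^ y : ℝ) : ℂ) • (1 : Matrix n n ℂ) := by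
  have h : ∀ s : NNReal, algebraMap NNReal (Matrix n n ℂ) s = ((s : ℝ) : ℂ) • 1 := fun s => by
    rw [Algebra.algebraMap_eq_smul_one]
    ext i j
    simp [NNReal.smul_def]
  lift t to NNReal using ht
  rw [CFC.rpow_eq_pow, ← h, CFC.rpow_algebraMap, h, NNReal.coe_rpow]

/-- A one-dimensional side-information system can be dropped. -/
lemma trace_mul_eq_trace_block_mul {N : Type*} [Fintype N] (X Y : Matrix (N × Unit) (N × Unit) ℂ) :
    (X * Y).trace = (block X () () * block Y () ()).trace := by
  rw [trace_mul_eq_sum_block, Fintype.sum_prod_type]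
  exact (Fintype.sum_unique _).trans (Fintype.sum_unique _)

lemma renyi2_eq {A : Type*} [Fintype A] [DecidableEq A] {ρ : Matrix A A ℂ} {t : ℝ} (ht : 0 < t)
    (hρ : ρ.trace = (t : ℂ)) : renyi2 ρ = negLog2 ((ρ * ρ).trace.re / t) := by
  have h1 : (1 : Matrix A A ℂ) ⊗ₖ marginalSnd
      (ρ.submatrix Prod.fst Prod.fst : Matrix (A × Unit) (A × Unit) ℂ) = (t : ℂ) • 1 := by
    have : marginalSnd (ρ.submatrix Prod.fst Prod.fst : Matrix (A × Unit) (A × Unit) ℂ) =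
        (t : ℂ) • 1 := by
      ext i j
      rw [← hρ]
      simp [marginalSnd, Matrix.trace]
    rw [this, Matrix.kronecker_smul, Matrix.one_kronecker_one]
  have h2 : ((ρ.submatrix Prod.fst Prod.fst : Matrix (A × Unit) (A × Unit) ℂ) *
      ρ.submatrix Prod.fst Prod.fst).trace = (ρ * ρ).trace :=
    trace_mul_eq_trace_block_mul _ _
  have h3 : t ^ (-1 / 2 : ℝ) * t ^ (-1 / 2 : ℝ) = t⁻¹ := by
    rw [← Real.rpow_add ht, ← Real.rpow_neg_one]
    norm_num
  rw [renyi2, condRenyi2, h1, rpow_smul_one ht.le]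
  simp only [Matrix.mul_smul, Matrix.smul_mul, mul_one, smul_smul, Matrix.trace_smul, h2,
    smul_eq_mul, ← Complex.ofReal_mul, h3, Complex.re_ofReal_mul]
  rw [div_eq_inv_mul]

lemma renyi2_zero {A : Type*} [Fintype A] [DecidableEq A] :
    renyi2 (0 : Matrix A A ℂ) = ⊤ := by
  simp [renyi2, condRenyi2, negLog2]

lemma le_rpow_of_le_negLog2 {x k : ℝ} (hx : 0 ≤ x) (h : (k : EReal) ≤ negLog2 x) :
    x ≤ 2 ^ (-k) := by
  rcases hx.eq_or_lt with rfl | hx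
  · positivity
  · rw [negLog2, if_neg hx.ne', EReal.coe_le_coe_iff] at h
    rw [← Real.logb_le_iff_le_rpow one_lt_two hx]
    linarith

lemma logb_le_negLog2 {x y : ℝ} (hx : 0 ≤ x) (h : x ≤ y⁻¹) :
    ((Real.logb 2 y : ℝ) : EReal) ≤ negLog2 x := by
  rcases hx.eq_or_lt with rfl | hx
  · simp [negLog2]
  · rw [negLog2, if_neg hx.ne', EReal.coe_le_coe_iff]
    have := Real.logb_le_logb_of_le one_lt_two hx h
    rw [Real.logb_inv] at this
    linarith

lemma trace_extractorOutput [Nonempty D] (U : D → Matrix.unitaryGroup (M × L) ℂ)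
    (ρ : Matrix (M × L) (M × L) ℂ) : (extractorOutput U ρ).trace = ρ.trace := by
  have hD : (Fintype.card D : ℂ) ≠ 0 := Nat.cast_ne_zero.mpr Fintype.card_ne_zero
  have h : ∀ A : Matrix (M × L) (M × L) ℂ, (marginalFst A).trace = A.trace := fun A => by
    simp [Matrix.trace, marginalFst, Fintype.sum_prod_type]
  simp only [extractorOutput, Matrix.trace_smul, Matrix.trace_sum, Matrix.trace_kronecker, h,
    trace_unitary_conj, basisProj, Matrix.trace_single_eq_same, mul_one, Finset.sum_const,
    Finset.card_univ, nsmul_eq_mul, smul_eq_mul]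
  rw [inv_mul_cancel_left₀ hD]

/-- Bounds on the purity of the extractor output. -/
theorem trace_extractorOutput_sq_le [Nonempty M] [Nonempty L]
    {U : D → Matrix.unitaryGroup (M × L) ℂ} (hU : IsUnitaryTwoDesign U)
    {ρ : Matrix (M × L) (M × L) ℂ} (hρ : ρ.IsHermitian) :
    0 ≤ (extractorOutput U ρ * extractorOutput U ρ).trace.re ∧
    (extractorOutput U ρ * extractorOutput U ρ).trace.re ≤
      (ρ.trace.re ^ 2 + (Fintype.card M / Fintype.card L : ℝ) * (ρ * ρ).trace.re) /
        (Fintype.card M * Fintype.card D) := by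
  have := hU.nonempty
  have hm : (0 : ℝ) < Fintype.card M := Nat.cast_pos.mpr Fintype.card_pos
  have hd : (0 : ℝ) < Fintype.card D := Nat.cast_pos.mpr Fintype.card_pos
  -- The operator `ρ`, regarded as having a one-dimensional side-information system.
  set X : Matrix ((M × L) × Unit) ((M × L) × Unit) ℂ := ρ.submatrix Prod.fst Prod.fst
  have hX : X.IsHermitian := hρ.submatrix _
  have hZ : ∀ i, block (rotatedMarginal (U i) X) () () =
      marginalFst ((U i : Matrix (M × L) (M × L) ℂ) * ρ *
        (U i : Matrix (M × L) (M × L) ℂ).conjTranspose) := fun i => by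
    rw [rotatedMarginal, block_traceMiddle, Matrix.conjTranspose_kronecker,
      Matrix.conjTranspose_one, block_kronecker_one_mul_mul]
    rfl
  have hXX : (X * X).trace = (ρ * ρ).trace := trace_mul_eq_trace_block_mul _ _
  have himre : ρ.trace.im = 0 := by
    have := congrArg Complex.im (Matrix.trace_conjTranspose ρ)
    rw [hρ.eq, Complex.star_def, Complex.conj_im] at this
    linarith
  have hXR : (marginalSnd X * marginalSnd X).trace.re = ρ.trace.re ^ 2 := by
    have : (marginalSnd X * marginalSnd X).trace = ρ.trace * ρ.trace :=
      (Fintype.sum_unique _).trans (Matrix.mul_apply.trans (Fintype.sum_unique _))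
    rw [this, Complex.mul_re, himre, sq, mul_zero, sub_zero]
  have hout : (extractorOutput U ρ * extractorOutput U ρ).trace.re =
      (Fintype.card D : ℝ)⁻¹ * ((Fintype.card D : ℝ)⁻¹ *
        ∑ i, (rotatedMarginal (U i) X * rotatedMarginal (U i) X).trace.re) := by
    have hc : (Fintype.card D : ℂ)⁻¹ = (((Fintype.card D : ℝ)⁻¹ : ℝ) : ℂ) := by push_cast; rfl
    rw [extractorOutput, Matrix.smul_mul, Matrix.mul_smul, Matrix.trace_smul, Matrix.trace_smul,
      trace_blockDiagonal_mul_self, hc, smul_eq_mul, smul_eq_mul, Complex.re_ofReal_mul,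
      Complex.re_ofReal_mul, Complex.re_sum]
    simp only [trace_mul_eq_trace_block_mul, hZ]
  have hav := average_purity_traceMiddle_le hU hX (marginalSnd_isHermitian hX)
    (Z := fun i => rotatedMarginal (U i) X) fun i => rfl
  rw [hXR, hXX] at hav
  constructor
  · rw [hout]
    have : 0 ≤ ∑ i, (rotatedMarginal (U i) X * rotatedMarginal (U i) X).trace.re :=
      Finset.sum_nonneg fun i _ => trace_mul_self_re_nonneg (rotatedMarginal_isHermitian _ hX)
    positivity
  · rw [le_div_iff₀ (by positivity), hout]
    refine le_trans (le_of_eq ?_) hav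
    field_simp

end Renyi

/-! ### The min-entropy condition -/

section MinEntropy

lemma exists_state_of_le_condMinEntropy {A B : Type*} [Fintype A] [Fintype B] [DecidableEq A]
    {ω : Matrix (A × B) (A × B) ℂ} {k k' : ℝ} (hk : (k : EReal) ≤ condMinEntropy ω)
    (hk' : k' < k) : ∃ σ : Matrix B B ℂ, IsState σ ∧ ∃ μ < -k',
      ((((2 : ℝ) ^ μ : ℝ) : ℂ) • ((1 : Matrix A A ℂ) ⊗ₖ σ) - ω).PosSemidef := by
  have h : (⨅ σ : {σ : Matrix B B ℂ // IsState σ},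
      maxRelEntropy ω ((1 : Matrix A A ℂ) ⊗ₖ σ.1)) < ((-k' : ℝ) : EReal) := by
    refine lt_of_le_of_lt (EReal.le_neg_of_le_neg hk) ?_
    rw [← EReal.coe_neg, EReal.coe_lt_coe_iff]
    linarith
  obtain ⟨σ, hσ⟩ := iInf_lt_iff.mp h
  obtain ⟨x, ⟨μ, rfl, hμ⟩, hx⟩ := sInf_lt_iff.mp hσ
  exact ⟨σ.1, σ.2, μ, EReal.coe_lt_coe_iff.mp hx, hμ⟩

/-- Mixing a dominating state with the maximally mixed state makes it invertible, at the price of a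
factor `2`. -/
lemma exists_posDef_dominating {A B : Type*} [Fintype A] [Fintype B] [DecidableEq A]
    [DecidableEq B] {ω : Matrix (A × B) (A × B) ℂ} {σ : Matrix B B ℂ} (hσ : IsState σ) {c : ℝ}
    (hc : 0 ≤ c) (h : ((c : ℂ) • ((1 : Matrix A A ℂ) ⊗ₖ σ) - ω).PosSemidef) :
    ∃ τ : Matrix B B ℂ, τ.PosDef ∧ τ.trace = 1 ∧
      (((2 * c : ℝ) : ℂ) • ((1 : Matrix A A ℂ) ⊗ₖ τ) - ω).PosSemidef := by
  have hB : Nonempty B := by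
    by_contra hB
    rw [not_nonempty_iff] at hB
    simpa [Matrix.trace] using hσ.2
  have hb : (0 : ℝ) < Fintype.card B := Nat.cast_pos.mpr Fintype.card_pos
  have hb' : (Fintype.card B : ℂ) ≠ 0 := Nat.cast_ne_zero.mpr Fintype.card_ne_zero
  have hpos : ∀ r : ℝ, 0 < r → (0 : ℂ) < (r : ℂ) := fun r hr => by exact_mod_cast hr
  refine ⟨((2⁻¹ : ℝ) : ℂ) • σ + ((2⁻¹ * (Fintype.card B : ℝ)⁻¹ : ℝ) : ℂ) • 1, ?_, ?_, ?_⟩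
  · refine Matrix.PosDef.posSemidef_add (hσ.1.smul (hpos _ (by norm_num)).le)
      (Matrix.PosDef.one.smul (hpos _ (by positivity)))
  · rw [Matrix.trace_add, Matrix.trace_smul, Matrix.trace_smul, hσ.2, Matrix.trace_one]
    push_cast
    simp only [smul_eq_mul]
    field_simp
    norm_num
  · have e : ((2 * c : ℝ) : ℂ) • ((1 : Matrix A A ℂ) ⊗ₖ (((2⁻¹ : ℝ) : ℂ) • σ +
        ((2⁻¹ * (Fintype.card B : ℝ)⁻¹ : ℝ) : ℂ) • (1 : Matrix B B ℂ))) - ω =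
        ((c : ℂ) • ((1 : Matrix A A ℂ) ⊗ₖ σ) - ω) +
          ((c * (Fintype.card B : ℝ)⁻¹ : ℝ) : ℂ) • (1 : Matrix (A × B) (A × B) ℂ) := by
      rw [Matrix.kronecker_add, Matrix.kronecker_smul, Matrix.kronecker_smul,
        Matrix.one_kronecker_one]
      push_cast
      module
    rw [e]
    refine h.add (Matrix.PosSemidef.one.smul ?_)
    exact_mod_cast (by positivity : 0 ≤ c * (Fintype.card B : ℝ)⁻¹)

end MinEntropy

/-- The choice of output size, solved for `|M| / |L| = |M|² / |N|`. -/
lemma card_div_card_eq {M L : Type*} [Fintype M] [Fintype L] [Nonempty M] [Nonempty L] {k ε : ℝ}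
    (hε : 0 < ε) (h : Real.logb 2 (Fintype.card M) =
      (Real.logb 2 (Fintype.card (M × L)) + k) / 2 - 1 / 2 * Real.logb 2 (1 / ε)) :
    (Fintype.card M / Fintype.card L : ℝ) = 2 ^ k * ε := by
  have hm : (0 : ℝ) < Fintype.card M := Nat.cast_pos.mpr Fintype.card_pos
  have hl : (0 : ℝ) < Fintype.card L := Nat.cast_pos.mpr Fintype.card_pos
  rw [Fintype.card_prod, Nat.cast_mul, Real.logb_mul hm.ne' hl.ne', one_div, one_div,
    Real.logb_inv] at h
  refine Real.logb_injOn_pos one_lt_two (Set.mem_Ioi.mpr (by positivity))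
    (Set.mem_Ioi.mpr (by positivity)) ?_
  rw [Real.logb_div hm.ne' hl.ne', Real.logb_mul (by positivity) hε.ne',
    Real.logb_rpow two_pos (by norm_num)]
  linarith

end QExt
end

theorem mainTheorem6 {M L D : Type*} [Fintype M] [Fintype L] [Fintype D]
    [DecidableEq M] [DecidableEq L] [DecidableEq D] [Nonempty M] [Nonempty L]
    (U : D → Matrix.unitaryGroup (M × L) ℂ) (hU : QExt.IsUnitaryTwoDesign U) :
    (∀ k ε : ℝ, k ∈ Set.Icc 0 (Real.logb 2 (Fintype.card (M × L))) → 0 < ε →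
      Real.logb 2 (Fintype.card M) =
        (Real.logb 2 (Fintype.card (M × L)) + k) / 2 - 1 / 2 * Real.logb 2 (1 / ε) →
      QExt.IsStrongRenyi2Extractor U k ε) ∧
    (∀ k ε : ℝ, k ∈ Set.Icc (-Real.logb 2 (Fintype.card (M × L)))
        (Real.logb 2 (Fintype.card (M × L))) → 0 < ε →
      Real.logb 2 (Fintype.card M) =
        (Real.logb 2 (Fintype.card (M × L)) + k) / 2 - 1 / 2 * Real.logb 2 (1 / ε) →
      QExt.IsStrongMinExtractorQSI U k (2 * √ε)) := by
  have := hU.nonempty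
  have hm : (0 : ℝ) < Fintype.card M := Nat.cast_pos.mpr Fintype.card_pos
  have hd : (0 : ℝ) < Fintype.card D := Nat.cast_pos.mpr Fintype.card_pos
  refine ⟨fun k ε _ hε hlog ρ hρ hk => ?_, fun k ε _ hε hlog R _ _ ρ hρ hk => ?_⟩
  · have hML := QExt.card_div_card_eq hε hlog
    obtain ⟨ht0, him⟩ := Complex.le_def.mp hρ.1.trace_nonneg
    have htr : ρ.trace = ((ρ.trace.re : ℝ) : ℂ) := Complex.ext rfl him.symm
    rcases ht0.eq_or_lt with h0 | ht
    · have hz : ρ = 0 := hρ.1.trace_eq_zero_iff.mp (by rw [htr, ← h0]; rfl)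
      have hout : QExt.extractorOutput U ρ = 0 := by
        rw [hz]
        ext p q
        simp [QExt.extractorOutput, QExt.marginalFst, Matrix.sum_apply]
      rw [hout, QExt.renyi2_zero]
      exact le_top
    · rw [Complex.zero_re] at ht
      rw [QExt.renyi2_eq ht htr] at hk
      rw [QExt.renyi2_eq ht ((QExt.trace_extractorOutput U ρ).trans htr)]
      obtain ⟨hnn, hle⟩ := QExt.trace_extractorOutput_sq_le hU hρ.1.isHermitian
      have hp := QExt.le_rpow_of_le_negLog2
        (div_nonneg (QExt.trace_mul_self_re_nonneg hρ.1.isHermitian) ht.le) hk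
      refine QExt.logb_le_negLog2 (div_nonneg hnn ht.le) ?_
      rw [div_le_iff₀ ht, inv_div]
      refine hle.trans ?_
      rw [div_mul_eq_mul_div (ε + 1)]
      refine (div_le_div_iff_of_pos_right (mul_pos hm hd)).mpr ?_
      rw [div_le_iff₀ ht] at hp
      have h1 := mul_le_mul_of_nonneg_left hp (show 0 ≤ (2 : ℝ) ^ k * ε by positivity)
      have h2 : (2 : ℝ) ^ k * 2 ^ (-k) = 1 := by
        rw [← Real.rpow_add two_pos, add_neg_cancel, Real.rpow_zero]
      have h3 : (2 : ℝ) ^ k * ε * (2 ^ (-k) * ρ.trace.re) = ε * ρ.trace.re := by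
        linear_combination ε * ρ.trace.re * h2
      have h4 : ρ.trace.re ^ 2 ≤ ρ.trace.re := by nlinarith [hρ.2]
      rw [hML]
      linarith
  · have hML := QExt.card_div_card_eq hε hlog
    -- The slack `4 = 2 * 2` in `(2√ε)² = 4ε` pays for an approximate minimizer `σ` with
    -- `μ < 1 - k`, and for replacing it by an invertible state.
    obtain ⟨σ, hσ, μ, hμ, hdom⟩ :=
      QExt.exists_state_of_le_condMinEntropy hk (show k - 1 < k by linarith)
    obtain ⟨τ, hτ, hτ1, hdom'⟩ :=
      QExt.exists_posDef_dominating hσ (Real.rpow_nonneg zero_le_two μ) hdom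
    obtain ⟨T, K, hT, hK, hTK, rfl⟩ := QExt.exists_fourth_root hτ
    have hmain := QExt.traceNorm_extractorOutputQSI_sub_sq_le hU hρ.1 hT hK hTK hdom'
    rw [hτ1, hρ.2, Complex.one_re, one_mul, mul_one, hML] at hmain
    have hμ' : (2 : ℝ) ^ μ ≤ 2 * 2 ^ (-k) := by
      calc (2 : ℝ) ^ μ ≤ 2 ^ (1 + -k) := Real.rpow_le_rpow_of_exponent_le one_le_two (by linarith)
        _ = 2 * 2 ^ (-k) := by rw [Real.rpow_add two_pos, Real.rpow_one]
    have h2 : (2 : ℝ) ^ k * 2 ^ (-k) = 1 := by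
      rw [← Real.rpow_add two_pos, add_neg_cancel, Real.rpow_zero]
    have h3 : (2 : ℝ) ^ k * ε * (2 * 2 ^ μ) ≤ (2 * √ε) ^ 2 := by
      have := mul_le_mul_of_nonneg_left hμ' (show 0 ≤ (2 : ℝ) ^ k * ε * 2 by positivity)
      rw [mul_pow, Real.sq_sqrt hε.le]
      have h4 : (2 : ℝ) ^ k * ε * 2 * (2 * 2 ^ (-k)) = 4 * ε := by linear_combination 4 * ε * h2
      linarith
    exact (abs_le_of_sq_le_sq' (hmain.trans h3) (by positivity)).2
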